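/- Let $F:\mathbb R^n\to\mathbb R^n$ and $g:\mathbb R^n\to\mathbb R^m$ be continuously differentiable, let $h(x)=Hx-c$ with $H\in\mathbb R^{k\times n}$, $c\in\mathbb R^k$, and let $\mathcal C=\{x\in\mathbb R^n : g(x)\le 0,\ h(x)=0\}$ be convex. Write $\mathrm{SOL}(F,\mathcal C)=\{x^*\in\mathcal C : (x-x^*)^\top F(x^*)\ge 0\ \ \forall x\in\mathcal C\}$ and assume $\mathrm{SOL}(F,\mathcal C)\ne\emptyset$. Suppose that the Mangasarian–Fromovitz constraint qualification (MFCQ) holds at every $x\in\mathcal C$: the gradients $\nabla h_1(x),\dots,\nabla h_k(x)$ are linearly independent, and there is $\xi\in\mathbb R^n$ with $\nabla g_i(x)^\top\xi<0$ for all $i$ with $g_i(x)=0$ and $\nabla h_j(x)^\top\xi=0$ for all $j$. For $x\in\mathbb R^n$ let $N_{\mathcal C}(x)=\{d: d^\top(x'-x)\le 0\ \ \forall x'\in\mathcal C\}$ and $T_{\mathcal C}(x)=\{\xi: d^\top\xi\le 0\ \ \forall d\in N_{\mathcal C}(x)\}$. The projected monotone flow is $$\dot x=\mathrm{proj}_{T_{\mathcal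 C}(x)}(-F(x)),$$ where $\mathrm{proj}$ is the Euclidean projection. Its solutions are the Carathéodory solutions on an interval $J\subseteq[0,\infty)$ with $0\in J$: (locally) absolutely continuous functions that satisfy the equation at almost every $t\in J$. An equilibrium is a point $x^*\in\mathcal C$ with $\mathrm{proj}_{T_{\mathcal C}(x^*)}(-F(x^*))=0$. From every $x_0\in\mathcal C$ there starts a solution on some interval $[0,T)$ with $T>0$; two solutions on the same interval with the same initial point in $\mathcal C$ coincide; and if $F$ is monotone, i.e. $(x_1-x_2)^\top(F(x_1)-F(x_2))\ge0$ for all $x_1,x_2\in\mathbb R^n$, then from every $x_0\in\mathcal C$ there starts a solution on $[0,\infty)$. Moreover: 1. $\mathcal C$ is forward invariant: every solution $x:J\to\mathbb R^n$ with $x(0)\in\mathcal C$ satisfies $x(t)\in\mathcal C$ for all $t\in J$. 2. $x^*$ is an equilibrium if and only if $x^*\in\mathrm{SOL}(F,\mathcal C)$. 3. If $x^*\in\mathrm{SOL}(F,\mathcal C)$ and $F$ is monotone, then $x^*$ is globally Lyapunov stable relative to $\mathcal C$: for every $\varepsilon>0$ there is $\delta>0$ such that every solution with $x(0)\in\mathcal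 C$, $\|x(0)-x^*\|<\delta$ satisfies $\|x(t)-x^*\|<\varepsilon$ for all $t\in J$; and for every $\delta>0$ there is $\varepsilon>0$ with the same property. 4. If $F$ is $\mu$-strongly monotone, i.e. $\mu>0$ and $(x_1-x_2)^\top(F(x_1)-F(x_2))\ge\mu\|x_1-x_2\|^2$ for all $x_1,x_2\in\mathbb R^n$, then the flow is contracting at rate $\mu$: any two solutions $x,y$ on the same interval $J$ with $x(0),y(0)\in\mathcal C$ satisfy $\|x(t)-y(t)\|\le e^{-\mu t}\|x(0)-y(0)\|$ for all $t\in J$. In particular $\mathrm{SOL}(F,\mathcal C)=\{x^*\}$ is a singleton and $x^*$ is globally exponentially stable relative to $\mathcal C$, with rate $\mu$: there is $M>0$ such that every solution with $x(0)\in\mathcal C$ satisfies $\|x(t)-x^*\|\le M e^{-\mu t}\|x(0)-x^*\|$ for all $t\in J$. -/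

import Mathlib

open MeasureTheory Set

noncomputable section

namespace ProjFlow

/-- `ℝⁿ` with the Euclidean norm. -/
abbrev E (n : ℕ) := EuclideanSpace ℝ (Fin n)

/-- The metric projection onto the closure of `C` (a set-valued map). -/
def proj {n : ℕ} (C : Set (E n)) (x : E n) : Set (E n) :=
  {y | y ∈ closure C ∧ ‖x - y‖ = Metric.infDist x C}

/-- The normal cone `N_C(x)`, for every `x ∈ ℝⁿ`. -/
def normalCone {n : ℕ} (C : Set (E n)) (x : E n) : Set (E n) :=
  {d | ∀ x' ∈ C, inner ℝ d (x' - x) ≤ 0}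

/-- The tangent cone `T_C(x)`, the polar of the normal cone. -/
def tangentCone {n : ℕ} (C : Set (E n)) (x : E n) : Set (E n) :=
  {ξ | ∀ d ∈ normalCone C x, inner ℝ d ξ ≤ 0}

/-- The solution set `SOL(F, C)` of the variational inequality `VI(F, C)`. -/
def SOL {n : ℕ} (F : E n → E n) (C : Set (E n)) : Set (E n) :=
  {xs | xs ∈ C ∧ ∀ x ∈ C, 0 ≤ inner ℝ (x - xs) (F xs)}

/-- `F` is monotone on `ℝⁿ` (in the sense of operators). -/
def MonotoneMap {n : ℕ} (F : E n → E n) : Prop :=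
  ∀ x₁ x₂, 0 ≤ inner ℝ (x₁ - x₂) (F x₁ - F x₂)

/-- `F` is `μ`-strongly monotone on `ℝⁿ`. -/
def StronglyMonotoneMap {n : ℕ} (μ : ℝ) (F : E n → E n) : Prop :=
  0 < μ ∧ ∀ x₁ x₂, μ * ‖x₁ - x₂‖ ^ 2 ≤ inner ℝ (x₁ - x₂) (F x₁ - F x₂)

/-- The affine map `h(x) = H x - c`. -/
def affineConstraint {n k : ℕ} (H : Matrix (Fin k) (Fin n) ℝ) (c : E k) (x : E n) : E k :=
  WithLp.toLp 2 (H.mulVec x.ofLp) - c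

/-- The constraint set `{x | g(x) ≤ 0, h(x) = 0}`. -/
def constraintSet {n m k : ℕ} (g : E n → E m) (h : E n → E k) : Set (E n) :=
  {x | (∀ i, g x i ≤ 0) ∧ h x = 0}

/-- The Mangasarian-Fromovitz constraint qualification at `x`. -/
def MFCQ {n m k : ℕ} (g : E n → E m) (h : E n → E k) (x : E n) : Prop :=
  LinearIndependent ℝ (fun j : Fin k => gradient (fun y => h y j) x) ∧
  ∃ ξ : E n,
    (∀ i, g x i = 0 → inner ℝ (gradient (fun y => g y i) x) ξ < 0) ∧
    (∀ j, inner ℝ (gradient (fun y => h y j) x) ξ = 0)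

/-- `x` is a Carathéodory solution, on the interval `J` with left end point `0 ∈ J`, of the
projected monotone flow `ẋ = proj_{T_C(x)}(-F(x))`. The values of `x` off `J` are irrelevant. -/
structure IsSolution {n : ℕ} (F : E n → E n) (C : Set (E n)) (J : Set ℝ) (x : ℝ → E n) :
    Prop where
  ordConnected : J.OrdConnected
  isLeast : IsLeast J 0
  absolutelyContinuous : ∀ b ∈ J, AbsolutelyContinuousOnInterval x 0 b
  ode : ∀ᵐ t, t ∈ J → ∃ v ∈ proj (tangentCone C (x t)) (-F (x t)), HasDerivAt x v t

/-- Every solution that starts in `C` stays in `C` as long as it exists. -/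
def ForwardInvariant {n : ℕ} (F : E n → E n) (C : Set (E n)) : Prop :=
  ∀ (J : Set ℝ) (x : ℝ → E n), IsSolution F C J x → x 0 ∈ C → ∀ t ∈ J, x t ∈ C

/-- `xs ∈ C` is a zero of the right-hand side of the projected monotone flow on `C`. -/
def IsEquilibrium {n : ℕ} (F : E n → E n) (C : Set (E n)) (xs : E n) : Prop :=
  xs ∈ C ∧ 0 ∈ proj (tangentCone C xs) (-F xs)

/-- Global Lyapunov stability relative to `C`: solutions that start in `C` close to `xs` stay close
to `xs`, and those that start in `C` within any given distance of `xs` stay within a uniform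
distance of it. -/
def GloballyLyapunovStable {n : ℕ} (F : E n → E n) (C : Set (E n)) (xs : E n) : Prop :=
  (∀ ε > 0, ∃ δ > 0, ∀ (J : Set ℝ) (x : ℝ → E n), IsSolution F C J x → x 0 ∈ C →
    ‖x 0 - xs‖ < δ → ∀ t ∈ J, ‖x t - xs‖ < ε) ∧
  (∀ δ > 0, ∃ ε > 0, ∀ (J : Set ℝ) (x : ℝ → E n), IsSolution F C J x → x 0 ∈ C →
    ‖x 0 - xs‖ < δ → ∀ t ∈ J, ‖x t - xs‖ < ε)

/-- The flow on `C` is contracting at rate `c` in the Euclidean norm. -/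
def Contracting {n : ℕ} (F : E n → E n) (C : Set (E n)) (c : ℝ) : Prop :=
  ∀ (J : Set ℝ) (x y : ℝ → E n), IsSolution F C J x → IsSolution F C J y → x 0 ∈ C → y 0 ∈ C →
    ∀ t ∈ J, ‖x t - y t‖ ≤ Real.exp (-c * t) * ‖x 0 - y 0‖

/-- Global exponential stability of `xs` relative to `C`, with rate `c`. -/
def GloballyExponentiallyStable {n : ℕ} (F : E n → E n) (C : Set (E n)) (xs : E n) (c : ℝ) :
    Prop :=
  0 < c ∧ ∃ M > 0, ∀ (J : Set ℝ) (x : ℝ → E n), IsSolution F C J x → x 0 ∈ C →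
    ∀ t ∈ J, ‖x t - xs‖ ≤ M * Real.exp (-c * t) * ‖x 0 - xs‖

/-- From every point of `C` there starts a solution on a nondegenerate interval, and two solutions
on a common interval with the same initial point in `C` coincide. -/
def WellPosed {n : ℕ} (F : E n → E n) (C : Set (E n)) : Prop :=
  (∀ x₀ ∈ C, ∃ T > 0, ∃ x : ℝ → E n, IsSolution F C (Ico 0 T) x ∧ x 0 = x₀) ∧
  (∀ (J : Set ℝ) (x y : ℝ → E n), IsSolution F C J x → IsSolution F C J y → x 0 ∈ C →
    x 0 = y 0 → ∀ t ∈ J, x t = y t)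

/-- From every point of `C` there starts a solution on `[0, ∞)`. -/
def GloballySolvable {n : ℕ} (F : E n → E n) (C : Set (E n)) : Prop :=
  ∀ x₀ ∈ C, ∃ x : ℝ → E n, IsSolution F C (Ici 0) x ∧ x 0 = x₀

end ProjFlow

end

/-!
At a point `x` of a closed convex set `C`, the projected velocity `v` differs from `-F x` by an
element of the normal cone: `⟪-F x - v, y - x⟫ ≤ 0` for all `y ∈ C`. Adding this inequality for two
solutions bounds the derivative of `‖x t - y t‖ ^ 2` by `-2 ⟪x t - y t, F (x t) - F (y t)⟫`, and
Gronwall's inequality gives contraction, uniqueness and, for a constant second solution, stability.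
At `x ∉ C`, the vector from the nearest point of `C` to `x` is normal, so the velocity, being
tangent, does not increase `infDist x C`: this is invariance.

For existence, truncate `C` to a compact convex set `K`. A limit of projected Euler steps along
an ultrafilter of step sizes is a Lipschitz curve in `K` with `⟪ẋ t + F (x t), z - x t⟫ ≥ 0` for
all `z ∈ K`, and a velocity of a curve in `K` is orthogonal to the normal cone, so `ẋ t` is the
projection of `-F (x t)` onto the tangent cone. Cones are local, so the truncation is invisible as
long as the curve stays in the interior of the truncating ball; if `F` is monotone and the ball is
centred at a solution of the variational inequality, this is forever.
-/

open Filter Topology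
open scoped NNReal

namespace ProjFlow

section AbsolutelyContinuous

variable {a b : ℝ}

lemma absolutelyContinuousOnInterval_lipschitz_comp {X Y : Type*} [PseudoMetricSpace X]
    [PseudoMetricSpace Y] {φ : X → Y} {L : ℝ≥0} (hφ : LipschitzWith L φ) {f : ℝ → X}
    (hf : AbsolutelyContinuousOnInterval f a b) :
    AbsolutelyContinuousOnInterval (fun t => φ (f t)) a b := by
  refine squeeze_zero (fun E => Finset.sum_nonneg fun i _ => dist_nonneg) (fun E => ?_)
    (by simpa using Tendsto.const_mul (L : ℝ) hf)
  rw [Finset.mul_sum]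
  exact Finset.sum_le_sum fun i _ => hφ.dist_le_mul _ _

lemma absolutelyContinuousOnInterval_lipschitz_comp_sq {X : Type*} [PseudoMetricSpace X]
    {φ : X → ℝ} {L : ℝ≥0} (hφ : LipschitzWith L φ) {f : ℝ → X}
    (hf : AbsolutelyContinuousOnInterval f a b) :
    AbsolutelyContinuousOnInterval (fun t => φ (f t) ^ 2) a b := by
  have hφf := absolutelyContinuousOnInterval_lipschitz_comp hφ hf
  simpa only [sq] using hφf.fun_mul hφf

lemma le_of_ae_deriv_nonpos {f : ℝ → ℝ} (hab : a ≤ b) (hf : AbsolutelyContinuousOnInterval f a b)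
    (hf' : ∀ᵐ t, t ∈ Icc a b → deriv f t ≤ 0) : f b ≤ f a := by
  have hint : ∫ t in a..b, deriv f t ≤ ∫ _ in a..b, (0 : ℝ) :=
    intervalIntegral.integral_mono_ae_restrict hab hf.intervalIntegrable_deriv
      intervalIntegrable_const ((ae_restrict_iff' measurableSet_Icc).2 hf')
  rw [hf.integral_deriv_eq_sub, intervalIntegral.integral_zero] at hint
  exact sub_nonpos.1 hint

lemma le_exp_mul_of_ae_deriv_le {f : ℝ → ℝ} {κ : ℝ} (hab : a ≤ b)
    (hf : AbsolutelyContinuousOnInterval f a b)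
    (hf' : ∀ᵐ t, t ∈ Icc a b → deriv f t ≤ -κ * f t) :
    f b ≤ Real.exp (-κ * (b - a)) * f a := by
  have hexp : AbsolutelyContinuousOnInterval (fun t => Real.exp (κ * t)) a b :=
    ContDiffOn.absolutelyContinuousOnInterval (ContDiff.contDiffOn (by fun_prop))
  have hweighted : Real.exp (κ * b) * f b ≤ Real.exp (κ * a) * f a := by
    refine le_of_ae_deriv_nonpos hab (hexp.fun_mul hf) ?_
    filter_upwards [hf', hf.boundedVariationOn.ae_differentiableAt_of_mem_uIcc]
      with t hle hdiff ht
    have hE : HasDerivAt (fun t => Real.exp (κ * t)) (Real.exp (κ * t) * (κ * 1)) t :=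
      ((hasDerivAt_id t).const_mul κ).exp
    rw [(hE.fun_mul (hdiff (Icc_subset_uIcc ht)).hasDerivAt).deriv]
    linarith [mul_le_mul_of_nonneg_left (hle ht) (Real.exp_pos (κ * t)).le]
  calc f b = Real.exp (-κ * b) * (Real.exp (κ * b) * f b) := by
        rw [← mul_assoc, ← Real.exp_add, neg_mul, neg_add_cancel, Real.exp_zero, one_mul]
    _ ≤ Real.exp (-κ * b) * (Real.exp (κ * a) * f a) := by gcongr
    _ = Real.exp (-κ * (b - a)) * f a := by
        rw [← mul_assoc, ← Real.exp_add]; ring_nf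

end AbsolutelyContinuous

lemma le_of_hasDerivAt_of_eventually_le {f : ℝ → ℝ} {f' c s : ℝ} (hf : HasDerivAt f f' s)
    (hle : ∀ᶠ t in 𝓝[>] s, f t ≤ f s + (t - s) * c) : f' ≤ c := by
  have hslope : Tendsto (slope f s) (𝓝[>] s) (𝓝 f') :=
    (hasDerivWithinAt_iff_tendsto_slope' self_notMem_Ioi).1 hf.hasDerivWithinAt
  refine le_of_tendsto hslope ?_
  filter_upwards [hle, self_mem_nhdsWithin] with t ht hst
  rw [slope_def_field, div_le_iff₀ (sub_pos.2 hst)]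
  linarith

section ProjectedEuler

lemma natFloor_sub_natFloor_le {a b : ℝ} (hab : a ≤ b) :
    (⌊b⌋₊ : ℝ) - ⌊a⌋₊ ≤ b - a + 1 := by
  have ha := Nat.lt_floor_add_one a
  rcases le_total 0 b with hb | hb
  · linarith [Nat.floor_le hb]
  · rw [Nat.floor_of_nonpos hb, Nat.floor_of_nonpos (hab.trans hb)]
    simp only [Nat.cast_zero]
    linarith

lemma natFloor_div_sub_natFloor_div_mul_le {s t h : ℝ} (hst : s ≤ t) (hh : 0 < h) :
    ((⌊t / h⌋₊ : ℝ) - ⌊s / h⌋₊) * h ≤ t - s + h := by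
  have hfloor := natFloor_sub_natFloor_le (div_le_div_of_nonneg_right hst hh.le)
  calc ((⌊t / h⌋₊ : ℝ) - ⌊s / h⌋₊) * h ≤ (t / h - s / h + 1) * h := by gcongr
    _ = t - s + h := by field_simp

lemma tendsto_natFloor_div_mul {t : ℝ} (ht : 0 ≤ t) :
    Tendsto (fun h : ℝ => (⌊t / h⌋₊ : ℝ) * h) (𝓝[>] 0) (𝓝 t) := by
  simpa [Function.comp_def, div_eq_mul_inv] using
    (tendsto_nat_floor_mul_div_atTop ht).comp tendsto_inv_nhdsGT_zero

lemma le_add_mul_of_forall_succ_le {f : ℕ → ℝ} {c : ℝ} {i j : ℕ} (hij : i ≤ j)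
    (hf : ∀ k, i ≤ k → k < j → f (k + 1) ≤ f k + c) : f j ≤ f i + (j - i) * c := by
  induction j, hij using Nat.le_induction with
  | base => simp
  | succ j hij ih =>
    have hprev := ih fun k hik hkj => hf k hik (hkj.trans j.lt_succ_self)
    have hlast := hf j hij j.lt_succ_self
    push_cast
    linarith

variable {V : Type*} [NormedAddCommGroup V] [InnerProductSpace ℝ V] {K : Set V} {F : V → V}

/-- `u` is a trajectory in `K` of the projected Euler scheme with step `h` for `ẋ = -F x`: each
`u (k + 1)` is the metric projection onto `K` of `u k - h • F (u k)`. For convex `K` the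
projection is characterized by the variational inequality in the second field. -/
structure IsProjectedEuler (K : Set V) (F : V → V) (h : ℝ) (u : ℕ → V) : Prop where
  mem : ∀ k, u k ∈ K
  inner_nonpos : ∀ k, ∀ z ∈ K, inner ℝ (u k - h • F (u k) - u (k + 1)) (z - u (k + 1)) ≤ 0

lemma exists_isProjectedEuler (hK : IsComplete K) (hconv : Convex ℝ K) {x₀ : V} (hx₀ : x₀ ∈ K)
    (F : V → V) (h : ℝ) : ∃ u : ℕ → V, u 0 = x₀ ∧ IsProjectedEuler K F h u := by
  have hproj : ∀ y : V, ∃ p ∈ K, ∀ z ∈ K, inner ℝ (y - p) (z - p) ≤ 0 := fun y => by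
    obtain ⟨p, hp, hmin⟩ := exists_norm_eq_iInf_of_complete_convex ⟨x₀, hx₀⟩ hK hconv y
    exact ⟨p, hp, (norm_eq_iInf_iff_real_inner_le_zero hconv hp).1 hmin⟩
  choose p hpK hp using hproj
  let u : ℕ → V := fun k => Nat.rec x₀ (fun _ y => p (y - h • F y)) k
  exact ⟨u, rfl, Nat.rec hx₀ fun _ _ => hpK _, fun k => hp (u k - h • F (u k))⟩

namespace IsProjectedEuler

variable {h : ℝ} {u : ℕ → V}

lemma dist_succ_le (hu : IsProjectedEuler K F h u) (hh : 0 ≤ h) (k : ℕ) :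
    dist (u k) (u (k + 1)) ≤ h * ‖F (u k)‖ := by
  have hvar := hu.inner_nonpos k (u k) (hu.mem k)
  rw [sub_right_comm, inner_sub_left, real_inner_self_eq_norm_sq, real_inner_smul_left] at hvar
  have hCS : h * inner ℝ (F (u k)) (u k - u (k + 1)) ≤ h * (‖F (u k)‖ * ‖u k - u (k + 1)‖) :=
    mul_le_mul_of_nonneg_left (real_inner_le_norm _ _) hh
  rw [dist_eq_norm]
  rcases (norm_nonneg (u k - u (k + 1))).eq_or_lt with hzero | hpos
  · rw [← hzero]
    positivity
  · refine le_of_mul_le_mul_right ?_ hpos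
    linarith

lemma dist_le (hu : IsProjectedEuler K F h u) (hh : 0 ≤ h) {M : ℝ} (hM : ∀ y ∈ K, ‖F y‖ ≤ M)
    {i j : ℕ} (hij : i ≤ j) : dist (u i) (u j) ≤ (j - i) * h * M := by
  have hstep : ∀ k, dist (u k) (u (k + 1)) ≤ h * M := fun k =>
    (hu.dist_succ_le hh k).trans (mul_le_mul_of_nonneg_left (hM _ (hu.mem k)) hh)
  have hsum := dist_le_Ico_sum_of_dist_le hij fun {k} _ _ => hstep k
  rwa [Finset.sum_const, Nat.card_Ico, nsmul_eq_mul, Nat.cast_sub hij, ← mul_assoc] at hsum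

lemma dist_natFloor_le (hu : IsProjectedEuler K F h u) (hh : 0 < h) {M : ℝ≥0}
    (hM : ∀ y ∈ K, ‖F y‖ ≤ M) {s t : ℝ} (hst : s ≤ t) {k : ℕ} (hsk : ⌊s / h⌋₊ ≤ k)
    (hkt : k ≤ ⌊t / h⌋₊) : dist (u ⌊s / h⌋₊) (u k) ≤ (t - s + h) * M :=
  calc dist (u ⌊s / h⌋₊) (u k) ≤ (k - ⌊s / h⌋₊) * h * M := hu.dist_le hh.le hM hsk
    _ ≤ (⌊t / h⌋₊ - ⌊s / h⌋₊) * h * M := by gcongr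
    _ ≤ (t - s + h) * M := by
      gcongr
      exact natFloor_div_sub_natFloor_div_mul_le hst hh

lemma norm_sub_sq_succ_le (hu : IsProjectedEuler K F h u) {z : V} (hz : z ∈ K) (k : ℕ) :
    ‖u (k + 1) - z‖ ^ 2 ≤ ‖u k - z‖ ^ 2 + h * (2 * inner ℝ (F (u k)) (z - u (k + 1))) := by
  have hvar := hu.inner_nonpos k z hz
  have hexpand := norm_add_sq_real (u k - u (k + 1)) (u (k + 1) - z)
  rw [sub_add_sub_cancel, ← neg_sub z (u (k + 1)), inner_neg_right, norm_neg,
    norm_sub_rev z] at hexpand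
  rw [sub_right_comm, inner_sub_left, real_inner_smul_left] at hvar
  linarith [sq_nonneg ‖u k - u (k + 1)‖]

lemma norm_sub_sq_le (hu : IsProjectedEuler K F h u) (hh : 0 ≤ h) {z : V} (hz : z ∈ K) {c : ℝ}
    {i j : ℕ} (hij : i ≤ j)
    (hc : ∀ k, i ≤ k → k < j → inner ℝ (F (u k)) (z - u (k + 1)) ≤ c) :
    ‖u j - z‖ ^ 2 ≤ ‖u i - z‖ ^ 2 + (j - i) * (h * (2 * c)) :=
  le_add_mul_of_forall_succ_le (f := fun k => ‖u k - z‖ ^ 2) hij fun k hik hkj =>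
    (hu.norm_sub_sq_succ_le hz k).trans (by gcongr; exact hc k hik hkj)

end IsProjectedEuler

lemma exists_forall_inner_sub_le (hF : ContinuousOn F K) {p z : V} (hp : p ∈ K) {c : ℝ}
    (hc : inner ℝ (F p) (z - p) < c) :
    ∃ δ > 0, ∀ y ∈ K, ∀ y' ∈ K, dist y p < δ → dist y' p < δ → inner ℝ (F y) (z - y') ≤ c := by
  have hcont : ContinuousOn (fun q : V × V => inner ℝ (F q.1) (z - q.2)) (K ×ˢ K) :=
    (hF.comp continuousOn_fst fun q hq => hq.1).inner (by fun_prop)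
  obtain ⟨δ, hδ, hball⟩ :=
    Metric.mem_nhdsWithin_iff.1 ((hcont (p, p) ⟨hp, hp⟩).eventually_lt_const hc)
  exact ⟨δ, hδ, fun y hy y' hy' hd hd' => le_of_lt (@hball (y, y') ⟨max_lt hd hd', hy, hy'⟩)⟩

/-- `x` is the pointwise limit, as the step `h > 0` tends to `0` along the filter `l`, of the step
functions `t ↦ u h ⌊t / h⌋₊` that interpolate trajectories `u h` of the projected Euler scheme with
step `h`. As `⌊·⌋₊` vanishes on negative numbers, `x` is constant on `(-∞, 0]`. -/
structure IsProjectedEulerLimit (l : Filter ℝ) (K : Set V) (F : V → V) (u : ℝ → ℕ → V)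
    (x : ℝ → V) : Prop where
  isProjectedEuler : ∀ h, IsProjectedEuler K F h (u h)
  le_nhdsGT : l ≤ 𝓝[>] 0
  tendsto : ∀ t, Tendsto (fun h => u h ⌊t / h⌋₊) l (𝓝 (x t))

lemma exists_isProjectedEulerLimit (hK : IsCompact K) (hconv : Convex ℝ K) {x₀ : V}
    (hx₀ : x₀ ∈ K) (F : V → V) :
    ∃ (l : Ultrafilter ℝ) (u : ℝ → ℕ → V) (x : ℝ → V),
      IsProjectedEulerLimit (l : Filter ℝ) K F u x ∧ x 0 = x₀ ∧ ∀ t, x t ∈ K := by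
  choose u hu₀ hu using exists_isProjectedEuler hK.isComplete hconv hx₀ F
  let l : Ultrafilter ℝ := .of (𝓝[>] 0)
  have hlim : ∀ t, ∃ y ∈ K, Tendsto (fun h => u h ⌊t / h⌋₊) l (𝓝 y) := fun t =>
    hK.ultrafilter_le_nhds (l.map fun h => u h ⌊t / h⌋₊)
      (tendsto_principal.2 (Eventually.of_forall fun h => (hu h).mem _))
  choose x hxK hx using hlim
  refine ⟨l, u, x, ⟨hu, Ultrafilter.of_le _, hx⟩, tendsto_nhds_unique (hx 0) ?_, hxK⟩
  simp [hu₀]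

namespace IsProjectedEulerLimit

variable {l : Filter ℝ} {u : ℝ → ℕ → V} {x : ℝ → V} {M : ℝ≥0} {s t : ℝ}

lemma eventually_pos (hx : IsProjectedEulerLimit l K F u x) : ∀ᶠ h in l, 0 < h :=
  hx.le_nhdsGT self_mem_nhdsWithin

lemma tendsto_sub_add_mul (hx : IsProjectedEulerLimit l K F u x) (s t M : ℝ) :
    Tendsto (fun h => (t - s + h) * M) l (𝓝 ((t - s) * M)) :=
  ((by fun_prop : Continuous fun h => (t - s + h) * M).tendsto' 0 _ (by simp)).mono_left
    (hx.le_nhdsGT.trans nhdsWithin_le_nhds)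

variable [l.NeBot]

lemma lipschitzWith (hx : IsProjectedEulerLimit l K F u x) (hM : ∀ y ∈ K, ‖F y‖ ≤ M) :
    LipschitzWith M x := by
  have hdist : ∀ {s t : ℝ}, s ≤ t → dist (x s) (x t) ≤ (t - s) * M := fun {s t} hst => by
    refine le_of_tendsto_of_tendsto ((hx.tendsto s).dist (hx.tendsto t))
      (hx.tendsto_sub_add_mul s t M) ?_
    filter_upwards [hx.eventually_pos] with h hh
    exact (hx.isProjectedEuler h).dist_natFloor_le hh hM hst
      (Nat.floor_mono (div_le_div_of_nonneg_right hst hh.le)) le_rfl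
  refine LipschitzWith.of_dist_le_mul fun s t => ?_
  rcases le_total s t with hst | hts
  · rw [dist_comm s, Real.dist_eq, abs_of_nonneg (sub_nonneg.2 hst), mul_comm]
    exact hdist hst
  · rw [dist_comm, Real.dist_eq, abs_of_nonneg (sub_nonneg.2 hts), mul_comm]
    exact hdist hts

lemma norm_sub_sq_le (hx : IsProjectedEulerLimit l K F u x) (hM : ∀ y ∈ K, ‖F y‖ ≤ M)
    (hs : 0 ≤ s) (hst : s ≤ t) {z : V} (hz : z ∈ K) {δ c : ℝ} (hδ : (t - s) * M < δ)
    (hc : ∀ y ∈ K, ∀ y' ∈ K, dist y (x s) < δ → dist y' (x s) < δ → inner ℝ (F y) (z - y') ≤ c) :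
    ‖x t - z‖ ^ 2 ≤ ‖x s - z‖ ^ 2 + (t - s) * (2 * c) := by
  have hduration : Tendsto (fun h => ((⌊t / h⌋₊ : ℝ) * h - ⌊s / h⌋₊ * h) * (2 * c)) l
      (𝓝 ((t - s) * (2 * c))) :=
    (((tendsto_natFloor_div_mul (hs.trans hst)).sub (tendsto_natFloor_div_mul hs)).mono_left
      hx.le_nhdsGT).mul_const _
  have hnear : ∀ᶠ h in l, (t - s + h) * M + dist (u h ⌊s / h⌋₊) (x s) < δ := by
    have hlim := (hx.tendsto_sub_add_mul s t M).add
      ((hx.tendsto s).dist (tendsto_const_nhds (x := x s)))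
    exact hlim.eventually_lt_const (by simpa using hδ)
  refine le_of_tendsto_of_tendsto (((hx.tendsto t).sub_const z).norm.pow 2)
    ((((hx.tendsto s).sub_const z).norm.pow 2).add hduration) ?_
  filter_upwards [hnear, hx.eventually_pos] with h hδ hh
  have hu := hx.isProjectedEuler h
  have hclose : ∀ k, ⌊s / h⌋₊ ≤ k → k ≤ ⌊t / h⌋₊ → dist (u h k) (x s) < δ := fun k hsk hkt =>
    calc dist (u h k) (x s)
        ≤ dist (u h ⌊s / h⌋₊) (u h k) + dist (u h ⌊s / h⌋₊) (x s) := dist_triangle_left _ _ _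
      _ ≤ (t - s + h) * M + dist (u h ⌊s / h⌋₊) (x s) := by
        gcongr
        exact hu.dist_natFloor_le hh hM hst hsk hkt
      _ < δ := hδ
  have hstep := hu.norm_sub_sq_le hh.le hz
    (Nat.floor_mono (div_le_div_of_nonneg_right hst hh.le)) fun k hsk hkt =>
      hc _ (hu.mem k) _ (hu.mem (k + 1)) (hclose k hsk hkt.le)
        (hclose (k + 1) (hsk.trans k.le_succ) hkt)
  exact hstep.trans_eq (by ring)

lemma inner_add_nonneg (hx : IsProjectedEulerLimit l K F u x) (hM : ∀ y ∈ K, ‖F y‖ ≤ M)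
    (hF : ContinuousOn F K) (hs : 0 ≤ s) (hxs : x s ∈ K) {v : V} (hv : HasDerivAt x v s) {z : V}
    (hz : z ∈ K) : 0 ≤ inner ℝ (v + F (x s)) (z - x s) := by
  suffices hle : ∀ c, inner ℝ (F (x s)) (z - x s) < c → inner ℝ v (x s - z) ≤ c by
    have := le_of_forall_gt_imp_ge_of_dense hle
    rw [← neg_sub, inner_neg_right] at this
    rw [inner_add_left]
    linarith
  intro c hc
  obtain ⟨δ, hδ, hball⟩ := exists_forall_inner_sub_le hF hxs hc
  have hevol : ∀ᶠ t in 𝓝[>] s, ‖x t - z‖ ^ 2 ≤ ‖x s - z‖ ^ 2 + (t - s) * (2 * c) := by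
    have hshort : ∀ᶠ t in 𝓝 s, (t - s) * (M : ℝ) < δ :=
      (by fun_prop : Continuous fun t => (t - s) * (M : ℝ)).continuousAt.eventually_lt_const
        (by simpa using hδ)
    filter_upwards [nhdsWithin_le_nhds hshort, self_mem_nhdsWithin] with t ht hst
    exact hx.norm_sub_sq_le hM hs (le_of_lt hst) hz ht hball
  have hderiv := le_of_hasDerivAt_of_eventually_le (hv.sub_const z).norm_sq hevol
  rw [real_inner_comm]
  linarith

end IsProjectedEulerLimit

end ProjectedEuler

end ProjFlow

namespace ProjFlow

variable {n : ℕ} {F : E n → E n} {C : Set (E n)}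

section Cones

lemma sub_mem_tangentCone {x y : E n} (hy : y ∈ C) : y - x ∈ tangentCone C x :=
  fun _ hd => hd y hy

lemma add_mem_tangentCone {x ξ η : E n} (hξ : ξ ∈ tangentCone C x) (hη : η ∈ tangentCone C x) :
    ξ + η ∈ tangentCone C x := fun d hd => by
  rw [inner_add_right]
  exact add_nonpos (hξ d hd) (hη d hd)

lemma isClosed_tangentCone (x : E n) : IsClosed (tangentCone C x) := by
  simp only [tangentCone, Set.ofPred_forall]
  exact isClosed_biInter fun d _ => isClosed_le (by fun_prop) continuous_const

lemma convex_tangentCone (x : E n) : Convex ℝ (tangentCone C x) := by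
  intro ξ hξ η hη a b ha hb _ d hd
  rw [inner_add_right, real_inner_smul_right, real_inner_smul_right]
  exact add_nonpos (mul_nonpos_of_nonneg_of_nonpos ha (hξ d hd))
    (mul_nonpos_of_nonneg_of_nonpos hb (hη d hd))

lemma mem_proj_iff {T : Set (E n)} (hcl : IsClosed T) (hconv : Convex ℝ T) {u v : E n} :
    v ∈ proj T u ↔ v ∈ T ∧ ∀ w ∈ T, inner ℝ (u - v) (w - v) ≤ 0 := by
  rw [proj, mem_ofPred_eq, hcl.closure_eq]
  refine and_congr_right fun hv => ?_
  rw [← norm_eq_iInf_iff_real_inner_le_zero hconv hv, Metric.infDist_eq_iInf]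
  simp_rw [dist_eq_norm]

lemma mem_proj_tangentCone_iff {x u v : E n} : v ∈ proj (tangentCone C x) u ↔
    v ∈ tangentCone C x ∧ ∀ w ∈ tangentCone C x, inner ℝ (u - v) (w - v) ≤ 0 :=
  mem_proj_iff (isClosed_tangentCone x) (convex_tangentCone x)

lemma sub_mem_normalCone_of_mem_proj (hcl : IsClosed C) (hconv : Convex ℝ C) {x p : E n}
    (hp : p ∈ proj C x) : x - p ∈ normalCone C x := fun y hy => by
  have hvar := ((mem_proj_iff hcl hconv).1 hp).2 y hy
  rw [← sub_sub_sub_cancel_right y x p, inner_sub_right]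
  exact sub_nonpos.2 (hvar.trans real_inner_self_nonneg)

lemma sub_mem_normalCone_of_mem_proj_tangentCone {x u v : E n}
    (hv : v ∈ proj (tangentCone C x) u) : u - v ∈ normalCone C x := fun y hy => by
  obtain ⟨hvT, hvar⟩ := mem_proj_tangentCone_iff.1 hv
  simpa only [add_sub_cancel_right] using
    hvar _ (add_mem_tangentCone (sub_mem_tangentCone hy) hvT)

lemma mem_proj_tangentCone_of_sub_mem_normalCone {x u v : E n}
    (hv : ∀ d ∈ normalCone C x, inner ℝ d v = 0) (huv : u - v ∈ normalCone C x) :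
    v ∈ proj (tangentCone C x) u := by
  refine mem_proj_tangentCone_iff.2 ⟨fun d hd => (hv d hd).le, fun w hw => ?_⟩
  rw [inner_sub_right, hv _ huv, sub_zero]
  exact hw _ huv

lemma inner_sub_sub_le_of_mem_proj_tangentCone {x y u u' v w : E n} (hx : x ∈ C) (hy : y ∈ C)
    (hv : v ∈ proj (tangentCone C x) u) (hw : w ∈ proj (tangentCone C y) u') :
    inner ℝ (x - y) (v - w) ≤ inner ℝ (x - y) (u - u') := by
  have hxy := sub_mem_normalCone_of_mem_proj_tangentCone hv y hy
  have hyx := sub_mem_normalCone_of_mem_proj_tangentCone hw x hx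
  rw [← neg_sub x y, inner_neg_right, real_inner_comm] at hxy
  rw [real_inner_comm] at hyx
  simp only [inner_sub_right] at hxy hyx ⊢
  linarith

lemma normalCone_inter_of_mem_nhds (hconv : Convex ℝ C) {x : E n} (hx : x ∈ C) {U : Set (E n)}
    (hU : U ∈ 𝓝 x) : normalCone (C ∩ U) x = normalCone C x := by
  refine Subset.antisymm (fun d hd z hz => ?_) fun d hd z hz => hd z hz.1
  have hsegment : Tendsto (fun ε : ℝ => x + ε • (z - x)) (𝓝[>] 0) (𝓝 x) :=
    ((by fun_prop : Continuous fun ε : ℝ => x + ε • (z - x)).tendsto' 0 x (by simp)).mono_left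
      nhdsWithin_le_nhds
  obtain ⟨ε, hεU, hε₀, hε₁⟩ :=
    ((hsegment.eventually_mem hU).and (Ioo_mem_nhdsGT (zero_lt_one (α := ℝ)))).exists
  have hle := hd _ ⟨hconv.add_smul_sub_mem hx hz ⟨hε₀.le, hε₁.le⟩, hεU⟩
  rw [add_sub_cancel_left, real_inner_smul_right] at hle
  exact nonpos_of_mul_nonpos_right hle hε₀

lemma tangentCone_inter_of_mem_nhds (hconv : Convex ℝ C) {x : E n} (hx : x ∈ C) {U : Set (E n)}
    (hU : U ∈ 𝓝 x) : tangentCone (C ∩ U) x = tangentCone C x := by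
  rw [tangentCone, tangentCone, normalCone_inter_of_mem_nhds hconv hx hU]

lemma isEquilibrium_iff_mem_SOL {xs : E n} : IsEquilibrium F C xs ↔ xs ∈ SOL F C := by
  have hnormal : -F xs ∈ normalCone C xs ↔ ∀ x ∈ C, 0 ≤ inner ℝ (x - xs) (F xs) := by
    refine forall₂_congr fun x _ => ?_
    rw [inner_neg_left, real_inner_comm, neg_nonpos]
  refine and_congr_right fun _ => ?_
  rw [← hnormal]
  refine ⟨fun h => ?_, fun h => ?_⟩
  · simpa only [sub_zero] using sub_mem_normalCone_of_mem_proj_tangentCone h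
  · exact mem_proj_tangentCone_of_sub_mem_normalCone (fun _ _ => inner_zero_right _)
      (by rwa [sub_zero])

end Cones

section Invariance

lemma eq_two_mul_inner_of_hasDerivAt_infDist_sq {V : Type*} [NormedAddCommGroup V]
    [InnerProductSpace ℝ V] {S : Set V} {x : ℝ → V} {v p : V} {t f' : ℝ}
    (hx : HasDerivAt x v t) (hpS : p ∈ S) (hp : Metric.infDist (x t) S = dist (x t) p)
    (hf : HasDerivAt (fun s => Metric.infDist (x s) S ^ 2) f' t) :
    f' = 2 * inner ℝ (x t - p) v := by
  have hmax : IsLocalMax ((fun s => Metric.infDist (x s) S ^ 2) - fun s => ‖x s - p‖ ^ 2) t := by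
    refine Eventually.of_forall fun s => ?_
    have hle : Metric.infDist (x s) S ^ 2 ≤ ‖x s - p‖ ^ 2 := by
      rw [← dist_eq_norm]
      exact pow_le_pow_left₀ Metric.infDist_nonneg (Metric.infDist_le_dist_of_mem hpS) 2
    simpa only [Pi.sub_apply, hp, dist_eq_norm, sub_self, sub_nonpos] using hle
  exact sub_eq_zero.1 (hmax.hasDerivAt_eq_zero (hf.sub (hx.sub_const p).norm_sq))

lemma IsSolution.ae_mem_Icc {J : Set ℝ} {x : ℝ → E n} (hx : IsSolution F C J x) {b : ℝ}
    (hb : b ∈ J) :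
    ∀ᵐ t, t ∈ Icc 0 b → ∃ v ∈ proj (tangentCone C (x t)) (-F (x t)), HasDerivAt x v t := by
  filter_upwards [hx.ode] with t ht hmem
  exact ht (hx.ordConnected.out hx.isLeast.1 hb hmem)

theorem forwardInvariant (hcl : IsClosed C) (hconv : Convex ℝ C) : ForwardInvariant F C := by
  intro J x hx hx₀ b hb
  have hne : C.Nonempty := ⟨_, hx₀⟩
  have hac : AbsolutelyContinuousOnInterval (fun t => Metric.infDist (x t) C ^ 2) 0 b :=
    absolutelyContinuousOnInterval_lipschitz_comp_sq (Metric.lipschitz_infDist_pt C)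
      (hx.absolutelyContinuous b hb)
  have hle : Metric.infDist (x b) C ^ 2 ≤ Metric.infDist (x 0) C ^ 2 := by
    refine le_of_ae_deriv_nonpos (hx.isLeast.2 hb) hac ?_
    filter_upwards [hx.ae_mem_Icc hb, hac.boundedVariationOn.ae_differentiableAt_of_mem_uIcc]
      with t hode hdiff ht
    obtain ⟨v, hv, hxv⟩ := hode ht
    obtain ⟨p, hpC, hp⟩ := hcl.exists_infDist_eq_dist hne (x t)
    have hnormal : x t - p ∈ normalCone C (x t) := sub_mem_normalCone_of_mem_proj hcl hconv
      ⟨subset_closure hpC, by rw [hp, dist_eq_norm]⟩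
    rw [eq_two_mul_inner_of_hasDerivAt_infDist_sq hxv hpC hp
      (hdiff (Icc_subset_uIcc ht)).hasDerivAt]
    exact mul_nonpos_of_nonneg_of_nonpos zero_le_two
      ((mem_proj_tangentCone_iff.1 hv).1 _ hnormal)
  rw [Metric.infDist_zero_of_mem hx₀, zero_pow two_ne_zero] at hle
  rw [hcl.mem_iff_infDist_zero hne]
  exact pow_eq_zero_iff two_ne_zero |>.1 (le_antisymm hle (sq_nonneg _))

end Invariance

section Contraction

variable {J : Set ℝ} {x y : ℝ → E n} {b κ : ℝ}

theorem IsSolution.norm_sub_le (hx : IsSolution F C J x) (hy : IsSolution F C J y)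
    (hcl : IsClosed C) (hconv : Convex ℝ C) (hx₀ : x 0 ∈ C) (hy₀ : y 0 ∈ C) (hb : b ∈ J)
    (hκ : ∀ t ∈ Icc 0 b, κ * ‖x t - y t‖ ^ 2 ≤ inner ℝ (x t - y t) (F (x t) - F (y t))) :
    ‖x b - y b‖ ≤ Real.exp (-κ * b) * ‖x 0 - y 0‖ := by
  have hac : AbsolutelyContinuousOnInterval (fun t => ‖x t - y t‖ ^ 2) 0 b :=
    absolutelyContinuousOnInterval_lipschitz_comp_sq lipschitzWith_one_norm
      ((hx.absolutelyContinuous b hb).fun_sub (hy.absolutelyContinuous b hb))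
  have hsq : ‖x b - y b‖ ^ 2 ≤ Real.exp (-(2 * κ) * (b - 0)) * ‖x 0 - y 0‖ ^ 2 := by
    refine le_exp_mul_of_ae_deriv_le (hx.isLeast.2 hb) hac ?_
    filter_upwards [hx.ae_mem_Icc hb, hy.ae_mem_Icc hb] with t hodex hodey ht
    obtain ⟨v, hv, hxv⟩ := hodex ht
    obtain ⟨w, hw, hyw⟩ := hodey ht
    have htJ : t ∈ J := hx.ordConnected.out hx.isLeast.1 hb ht
    have hvel := inner_sub_sub_le_of_mem_proj_tangentCone
      (forwardInvariant hcl hconv J x hx hx₀ t htJ) (forwardInvariant hcl hconv J y hy hy₀ t htJ)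
      hv hw
    rw [neg_sub_neg, ← neg_sub (F (x t)), inner_neg_right] at hvel
    rw [((hxv.fun_sub hyw).norm_sq).deriv]
    linarith [hκ t ht]
  rw [sub_zero] at hsq
  refine le_of_sq_le_sq ?_ (by positivity)
  rwa [mul_pow, ← Real.exp_nat_mul, Nat.cast_ofNat, ← mul_assoc, mul_neg]

theorem contracting_of_forall_mul_norm_sub_sq_le (hcl : IsClosed C) (hconv : Convex ℝ C)
    (hκ : ∀ x₁ x₂, κ * ‖x₁ - x₂‖ ^ 2 ≤ inner ℝ (x₁ - x₂) (F x₁ - F x₂)) : Contracting F C κ :=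
  fun _ _ _ hx hy hx₀ hy₀ _ ht => hx.norm_sub_le hy hcl hconv hx₀ hy₀ ht fun _ _ => hκ _ _

theorem MonotoneMap.contracting (hF : MonotoneMap F) (hcl : IsClosed C) (hconv : Convex ℝ C) :
    Contracting F C 0 :=
  contracting_of_forall_mul_norm_sub_sq_le hcl hconv fun x₁ x₂ => by
    simpa only [zero_mul] using hF x₁ x₂

/- A map that is Lipschitz with constant `L` is strongly monotone with the negative modulus `-L`, so
uniqueness is an instance of the contraction estimate. -/
theorem IsSolution.eq_of_locallyLipschitzOn (hx : IsSolution F C J x) (hy : IsSolution F C J y)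
    (hcl : IsClosed C) (hconv : Convex ℝ C) (hF : LocallyLipschitzOn C F) (hx₀ : x 0 ∈ C)
    (h₀ : x 0 = y 0) (hb : b ∈ J) : x b = y b := by
  have hcompact : ∀ {z : ℝ → E n}, IsSolution F C J z → IsCompact (z '' Icc 0 b) := fun hz =>
    isCompact_Icc.image_of_continuousOn
      (uIcc_of_le (hz.isLeast.2 hb) ▸ (hz.absolutelyContinuous b hb).continuousOn)
  have hrange : ∀ {z : ℝ → E n}, IsSolution F C J z → z 0 ∈ C → z '' Icc 0 b ⊆ C :=
    fun hz hz₀ => image_subset_iff.2 fun t ht => forwardInvariant hcl hconv J _ hz hz₀ t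
      (hz.ordConnected.out hz.isLeast.1 hb ht)
  have hy₀ : y 0 ∈ C := h₀ ▸ hx₀
  obtain ⟨L, hL⟩ := LocallyLipschitzOn.exists_lipschitzOnWith_of_compact
    ((hcompact hx).union (hcompact hy)) (hF.mono (union_subset (hrange hx hx₀) (hrange hy hy₀)))
  have hle : ‖x b - y b‖ ≤ Real.exp (-(-L) * b) * ‖x 0 - y 0‖ := by
    refine hx.norm_sub_le hy hcl hconv hx₀ hy₀ hb fun t ht => ?_
    have hLip : ‖F (x t) - F (y t)‖ ≤ L * ‖x t - y t‖ :=
      hL.norm_sub_le (.inl (mem_image_of_mem x ht)) (.inr (mem_image_of_mem y ht))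
    have hCS := neg_le_of_abs_le (abs_real_inner_le_norm (x t - y t) (F (x t) - F (y t)))
    linarith [mul_le_mul_of_nonneg_left hLip (norm_nonneg (x t - y t))]
  rw [h₀, sub_self, norm_zero, mul_zero] at hle
  exact sub_eq_zero.1 (norm_le_zero_iff.1 hle)

lemma isSolution_const (hJ : J.OrdConnected) (h₀ : IsLeast J 0) {xs : E n} (hxs : xs ∈ SOL F C) :
    IsSolution F C J fun _ => xs where
  ordConnected := hJ
  isLeast := h₀
  absolutelyContinuous _ _ :=
    ((LipschitzWith.const xs).lipschitzOnWith (K := 0)).absolutelyContinuousOnInterval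
  ode := .of_forall fun t _ =>
    ⟨0, (isEquilibrium_iff_mem_SOL.2 hxs).2, hasDerivAt_const t xs⟩

namespace Contracting

variable {xs : E n}

lemma norm_sub_le (hκ : Contracting F C κ) (hxs : xs ∈ SOL F C) (hx : IsSolution F C J x)
    (hx₀ : x 0 ∈ C) {t : ℝ} (ht : t ∈ J) : ‖x t - xs‖ ≤ Real.exp (-κ * t) * ‖x 0 - xs‖ :=
  hκ J x _ hx (isSolution_const hx.ordConnected hx.isLeast hxs) hx₀ hxs.1 t ht

theorem globallyLyapunovStable (h : Contracting F C 0) (hxs : xs ∈ SOL F C) :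
    GloballyLyapunovStable F C xs := by
  have hstay : ∀ (δ : ℝ) (J : Set ℝ) (x : ℝ → E n), IsSolution F C J x → x 0 ∈ C →
      ‖x 0 - xs‖ < δ → ∀ t ∈ J, ‖x t - xs‖ < δ := fun δ J x hx hx₀ hδ t ht =>
    lt_of_le_of_lt (by simpa using h.norm_sub_le hxs hx hx₀ ht) hδ
  exact ⟨fun ε hε => ⟨ε, hε, hstay ε⟩, fun δ hδ => ⟨δ, hδ, hstay δ⟩⟩

theorem globallyExponentiallyStable (h : Contracting F C κ) (hκ : 0 < κ) (hxs : xs ∈ SOL F C) :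
    GloballyExponentiallyStable F C xs κ :=
  ⟨hκ, 1, one_pos, fun J x hx hx₀ t ht => by
    simpa only [one_mul] using h.norm_sub_le hxs hx hx₀ ht⟩

end Contracting

theorem StronglyMonotoneMap.subsingleton_SOL {μ : ℝ} (hF : StronglyMonotoneMap μ F) :
    (SOL F C).Subsingleton := by
  intro x hx y hy
  have hxy := hx.2 y hy.1
  have hyx := hy.2 x hx.1
  have hstrong := hF.2 x y
  rw [← neg_sub x y, inner_neg_left] at hxy
  rw [inner_sub_right] at hstrong
  have hsq : ‖x - y‖ ^ 2 ≤ 0 := nonpos_of_mul_nonpos_right (by linarith) hF.1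
  rwa [sq_nonpos_iff, norm_eq_zero, sub_eq_zero] at hsq

end Contraction

section Existence

variable {J : Set ℝ} {x : ℝ → E n}

lemma inner_eq_zero_of_mem_normalCone {v d : E n} {t : ℝ} (hv : HasDerivAt x v t)
    (hx : ∀ᶠ s in 𝓝 t, x s ∈ C) (hd : d ∈ normalCone C (x t)) : inner ℝ d v = 0 := by
  have hderiv : HasDerivAt (fun s => inner ℝ d (x s - x t)) (inner ℝ d v) t := by
    simpa using (hasDerivAt_const t d).inner ℝ (hv.sub_const (x t))
  refine IsLocalMax.hasDerivAt_eq_zero (hx.mono fun s hs => ?_) hderiv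
  simpa using hd _ hs

theorem exists_isSolution_of_isCompact {K : Set (E n)} (hK : IsCompact K) (hconv : Convex ℝ K)
    (hF : ContinuousOn F K) {x₀ : E n} (hx₀ : x₀ ∈ K) :
    ∃ x : ℝ → E n, Continuous x ∧ x 0 = x₀ ∧ IsSolution F K (Ici 0) x := by
  obtain ⟨M, hM⟩ := hK.exists_bound_of_continuousOn hF
  replace hM : ∀ y ∈ K, ‖F y‖ ≤ M.toNNReal := fun y hy => (hM y hy).trans (Real.le_coe_toNNReal M)
  obtain ⟨l, u, x, hx, h₀, hxK⟩ := exists_isProjectedEulerLimit hK hconv hx₀ F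
  have hLip := hx.lipschitzWith hM
  refine ⟨x, hLip.continuous, h₀, ordConnected_Ici, isLeast_Ici, fun _ _ =>
    hLip.lipschitzOnWith.absolutelyContinuousOnInterval, ?_⟩
  filter_upwards [hLip.ae_differentiableAt_real] with t hdiff ht
  refine ⟨deriv x t, mem_proj_tangentCone_of_sub_mem_normalCone (fun d hd => ?_)
    fun z hz => ?_, hdiff.hasDerivAt⟩
  · exact inner_eq_zero_of_mem_normalCone hdiff.hasDerivAt (.of_forall hxK) hd
  · rw [← neg_add', add_comm, inner_neg_left, neg_nonpos]
    exact hx.inner_add_nonneg hM hF ht (hxK t) hdiff.hasDerivAt hz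

lemma IsSolution.mono (hx : IsSolution F C J x) {I : Set ℝ} (hI : I.OrdConnected)
    (h₀ : IsLeast I 0) (hIJ : I ⊆ J) : IsSolution F C I x where
  ordConnected := hI
  isLeast := h₀
  absolutelyContinuous b hb := hx.absolutelyContinuous b (hIJ hb)
  ode := hx.ode.mono fun _ ht htI => ht (hIJ htI)

lemma IsSolution.of_inter {U : Set (E n)} (hx : IsSolution F (C ∩ U) J x) (hconv : Convex ℝ C)
    (hxC : ∀ t ∈ J, x t ∈ C) (hU : ∀ t ∈ J, U ∈ 𝓝 (x t)) : IsSolution F C J x where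
  ordConnected := hx.ordConnected
  isLeast := hx.isLeast
  absolutelyContinuous := hx.absolutelyContinuous
  ode := hx.ode.mono fun t ht htJ => by
    rw [← tangentCone_inter_of_mem_nhds hconv (hxC t htJ) (hU t htJ)]
    exact ht htJ

theorem exists_isSolution_Ico (hcl : IsClosed C) (hconv : Convex ℝ C) (hF : ContinuousOn F C)
    {x₀ : E n} (hx₀ : x₀ ∈ C) :
    ∃ T > 0, ∃ x : ℝ → E n, IsSolution F C (Ico 0 T) x ∧ x 0 = x₀ := by
  have hK : IsCompact (C ∩ Metric.closedBall x₀ 1) := (isCompact_closedBall x₀ 1).inter_left hcl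
  have hKconv := hconv.inter (convex_closedBall x₀ 1)
  have hx₀K : x₀ ∈ C ∩ Metric.closedBall x₀ 1 := ⟨hx₀, Metric.mem_closedBall_self zero_le_one⟩
  obtain ⟨x, hcont, h₀, hx⟩ :=
    exists_isSolution_of_isCompact hK hKconv (hF.mono inter_subset_left) hx₀K
  have hstart : x ⁻¹' Metric.ball x₀ 1 ∈ 𝓝[≥] 0 := mem_nhdsWithin_of_mem_nhds <|
    hcont.continuousAt.preimage_mem_nhds (h₀ ▸ Metric.ball_mem_nhds _ one_pos)
  obtain ⟨T, hT, hball⟩ := mem_nhdsGE_iff_exists_Ico_subset.1 hstart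
  refine ⟨T, hT, x, (hx.mono ordConnected_Ico (isLeast_Ico hT) Ico_subset_Ici_self).of_inter hconv
    (fun t ht => ?_) fun t ht => ?_, h₀⟩
  · exact (forwardInvariant hK.isClosed hKconv _ x hx (h₀ ▸ hx₀K) t ht.1).1
  · exact Metric.closedBall_mem_nhds_of_mem (hball ht)

theorem MonotoneMap.globallySolvable (hmono : MonotoneMap F) (hcl : IsClosed C)
    (hconv : Convex ℝ C) (hF : ContinuousOn F C) (hSOL : (SOL F C).Nonempty) :
    GloballySolvable F C := by
  obtain ⟨xs, hxs⟩ := hSOL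
  intro x₀ hx₀
  set R := ‖x₀ - xs‖ + 1
  have hK : IsCompact (C ∩ Metric.closedBall xs R) := (isCompact_closedBall xs R).inter_left hcl
  have hKconv := hconv.inter (convex_closedBall xs R)
  have hx₀K : x₀ ∈ C ∩ Metric.closedBall xs R :=
    ⟨hx₀, mem_closedBall_iff_norm.2 (lt_add_one _).le⟩
  have hxsK : xs ∈ SOL F (C ∩ Metric.closedBall xs R) :=
    ⟨⟨hxs.1, Metric.mem_closedBall_self (by positivity)⟩, fun z hz => hxs.2 z hz.1⟩
  obtain ⟨x, -, rfl, hx⟩ :=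
    exists_isSolution_of_isCompact hK hKconv (hF.mono inter_subset_left) hx₀K
  have hstay : ∀ t ∈ Ici (0 : ℝ), x t ∈ Metric.ball xs R := fun t ht => by
    have hle := (hmono.contracting hK.isClosed hKconv).norm_sub_le hxsK hx hx₀K ht
    rw [neg_zero, zero_mul, Real.exp_zero, one_mul] at hle
    exact mem_ball_iff_norm.2 (hle.trans_lt (lt_add_one _))
  exact ⟨x, hx.of_inter hconv
    (fun t ht => (forwardInvariant hK.isClosed hKconv _ x hx hx₀K t ht).1)
    fun t ht => Metric.closedBall_mem_nhds_of_mem (hstay t ht), rfl⟩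

theorem wellPosed (hcl : IsClosed C) (hconv : Convex ℝ C) (hF : LocallyLipschitzOn C F) :
    WellPosed F C :=
  ⟨fun _ hx₀ => exists_isSolution_Ico hcl hconv hF.continuousOn hx₀,
    fun _ _ _ hx hy hx₀ h₀ _ ht => hx.eq_of_locallyLipschitzOn hy hcl hconv hF hx₀ h₀ ht⟩

end Existence

section ConstraintSet

lemma isClosed_constraintSet {m k : ℕ} {g : E n → E m} {h : E n → E k} (hg : Continuous g)
    (hh : Continuous h) : IsClosed (constraintSet g h) := by
  simp only [constraintSet, Set.ofPred_and, Set.ofPred_forall]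
  exact (isClosed_iInter fun i => isClosed_le (by fun_prop) continuous_const).inter
    (isClosed_eq hh continuous_const)

lemma continuous_affineConstraint {k : ℕ} (H : Matrix (Fin k) (Fin n) ℝ) (c : E k) :
    Continuous (affineConstraint H c) :=
  ((PiLp.continuous_toLp 2 _).comp
    (Continuous.matrix_mulVec continuous_const (PiLp.continuous_ofLp 2 _))).sub continuous_const

end ConstraintSet

end ProjFlow

theorem mainTheorem9_general {n : ℕ} {F : ProjFlow.E n → ProjFlow.E n} {C : Set (ProjFlow.E n)}
    (hF : LocallyLipschitzOn C F) (hcl : IsClosed C) (hconv : Convex ℝ C)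
    (hSOL : (ProjFlow.SOL F C).Nonempty) :
    (ProjFlow.WellPosed F C ∧ (ProjFlow.MonotoneMap F → ProjFlow.GloballySolvable F C)) ∧
    ProjFlow.ForwardInvariant F C ∧
    (∀ xs, ProjFlow.IsEquilibrium F C xs ↔ xs ∈ ProjFlow.SOL F C) ∧
    (ProjFlow.MonotoneMap F → ∀ xs ∈ ProjFlow.SOL F C, ProjFlow.GloballyLyapunovStable F C xs) ∧
    (∀ μ : ℝ, ProjFlow.StronglyMonotoneMap μ F →
      ProjFlow.Contracting F C μ ∧
      ∃ xs, ProjFlow.SOL F C = {xs} ∧ ProjFlow.GloballyExponentiallyStable F C xs μ) := by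
  refine ⟨⟨ProjFlow.wellPosed hcl hconv hF,
      fun hmono => hmono.globallySolvable hcl hconv hF.continuousOn hSOL⟩,
    ProjFlow.forwardInvariant hcl hconv, fun _ => ProjFlow.isEquilibrium_iff_mem_SOL,
    fun hmono _ hxs => (hmono.contracting hcl hconv).globallyLyapunovStable hxs, fun μ hμ => ?_⟩
  have hcontr := ProjFlow.contracting_of_forall_mul_norm_sub_sq_le hcl hconv hμ.2
  obtain ⟨xs, hxs⟩ := hSOL
  exact ⟨hcontr, xs, hμ.subsingleton_SOL.eq_singleton_of_mem hxs,
    hcontr.globallyExponentiallyStable hμ.1 hxs⟩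

theorem mainTheorem9 {n m k : ℕ}
    (F : ProjFlow.E n → ProjFlow.E n) (hF : ContDiff ℝ 1 F)
    (g : ProjFlow.E n → ProjFlow.E m) (hg : ContDiff ℝ 1 g)
    (H : Matrix (Fin k) (Fin n) ℝ) (c : ProjFlow.E k)
    (C : Set (ProjFlow.E n))
    (hC : C = ProjFlow.constraintSet g (ProjFlow.affineConstraint H c))
    (hconv : Convex ℝ C)
    (hSOL : (ProjFlow.SOL F C).Nonempty)
    (hMFCQ : ∀ x ∈ C, ProjFlow.MFCQ g (ProjFlow.affineConstraint H c) x) :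
    -- the flow is well posed on `C`, and complete if `F` is monotone
    (ProjFlow.WellPosed F C ∧ (ProjFlow.MonotoneMap F → ProjFlow.GloballySolvable F C)) ∧
    -- (i)
    ProjFlow.ForwardInvariant F C ∧
    -- (ii)
    (∀ xs, ProjFlow.IsEquilibrium F C xs ↔ xs ∈ ProjFlow.SOL F C) ∧
    -- (iii)
    (ProjFlow.MonotoneMap F → ∀ xs ∈ ProjFlow.SOL F C, ProjFlow.GloballyLyapunovStable F C xs) ∧
    -- (iv)
    (∀ μ : ℝ, ProjFlow.StronglyMonotoneMap μ F →
      ProjFlow.Contracting F C μ ∧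
      ∃ xs, ProjFlow.SOL F C = {xs} ∧ ProjFlow.GloballyExponentiallyStable F C xs μ) := by
  have hcl : IsClosed C := hC ▸ ProjFlow.isClosed_constraintSet hg.continuous
    (ProjFlow.continuous_affineConstraint H c)
  exact mainTheorem9_general hF.locallyLipschitz.locallyLipschitzOn hcl hconv hSOL
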